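/- Let $A$ be a commutative von Neumann algebra, that is, a commutative unital complex C*-algebra together with a predual: a complex Banach space $A_*$ and an isometric isomorphism $\int\colon A\to (A_*)^*$ of complex Banach spaces. Regard an element $\mu\in A_*$ as the functional $a\mapsto \left(\int a\right)(\mu)$ on $A$. Let $\mathrm{ProjAlg}(A)=\{x\in A\mid x^*=x,\ x^2=x\}$ be the Boolean algebra of projections of $A$, with $a\wedge b=ab$ and $a\vee b=a+b-ab$. A complex continuous valuation on $\mathrm{ProjAlg}(A)$ is a map $\nu\colon \mathrm{ProjAlg}(A)\to\mathbb{C}$ such that $\nu(0)=0$, $\nu(x)+\nu(y)=\nu(x\vee y)+\nu(x\wedge y)$ for all $x,y$, and $\nu(\sup I)=\lim_{x\in I}\nu(x)$ for every directed subset $I$ that has a supremum. Then restriction along the inclusion $\mathrm{ProjAlg}(A)\to A$ establishes a (linear) bijection from $A_*$ to the vector space of complex continuous valuations on $\mathrm{ProjAlg}(A)$. -/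

import Mathlib

open Filter Topology

/-- The set of projections (self-adjoint idempotents) of a commutative `*`-ring `A`. -/
def ProjAlg (A : Type*) [CommRing A] [StarRing A] : Type _ :=
  {x : A // IsStarProjection x}

namespace ProjAlg

/-- The Boolean algebra of projections: `a ≤ b` means `a * b = a`, the meet is `a * b`, the join is
`a + b - a * b` and the complement is `1 - a`. The corresponding Boolean ring has the
multiplication of `A` and the addition `(a - b) ^ 2`. -/
instance instBooleanAlgebra (A : Type*) [CommRing A] [StarRing A] : BooleanAlgebra (ProjAlg A) where
  le a b := a.1 * b.1 = a.1
  le_refl a := a.2.isIdempotentElem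
  le_trans a b c hab hbc := by
    rw [← hab, mul_assoc, hbc]
  le_antisymm a b hab hba := Subtype.ext (by rw [← hab, mul_comm, hba])
  inf a b := ⟨a.1 * b.1, a.2.mul b.2 (Commute.all _ _)⟩
  inf_le_left a b := by
    change a.1 * b.1 * a.1 = a.1 * b.1
    rw [mul_right_comm, a.2.isIdempotentElem.eq]
  inf_le_right a b := by
    change a.1 * b.1 * b.1 = a.1 * b.1
    rw [mul_assoc, b.2.isIdempotentElem.eq]
  le_inf a b c hab hac := by
    change a.1 * (b.1 * c.1) = a.1
    rw [← mul_assoc, hab, hac]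
  sup a b := ⟨a.1 + b.1 - a.1 * b.1, IsStarProjection.add_sub_mul_of_commute (Commute.all _ _) a.2 b.2⟩
  le_sup_left a b := by
    change a.1 * (a.1 + b.1 - a.1 * b.1) = a.1
    have ha := a.2.isIdempotentElem.eq
    linear_combination (1 - b.1) * ha
  le_sup_right a b := by
    change b.1 * (a.1 + b.1 - a.1 * b.1) = b.1
    have hb := b.2.isIdempotentElem.eq
    linear_combination (1 - a.1) * hb
  sup_le a b c hac hbc := by
    change (a.1 + b.1 - a.1 * b.1) * c.1 = a.1 + b.1 - a.1 * b.1
    have h₁ : a.1 * c.1 = a.1 := hac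
    have h₂ : b.1 * c.1 = b.1 := hbc
    linear_combination h₁ + (1 - a.1) * h₂
  le_sup_inf a b c := by
    change (a.1 + b.1 - a.1 * b.1) * (a.1 + c.1 - a.1 * c.1) * (a.1 + b.1 * c.1 - a.1 * (b.1 * c.1))
      = (a.1 + b.1 - a.1 * b.1) * (a.1 + c.1 - a.1 * c.1)
    have ha := a.2.isIdempotentElem.eq
    have hb := b.2.isIdempotentElem.eq
    have hc := c.2.isIdempotentElem.eq
    have key : (a.1 + b.1 - a.1 * b.1) * (a.1 + c.1 - a.1 * c.1)
        = a.1 + b.1 * c.1 - a.1 * (b.1 * c.1) := by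
      linear_combination (1 - b.1) * (1 - c.1) * ha
    have hbc : (b.1 * c.1) * (b.1 * c.1) = b.1 * c.1 := by
      linear_combination c.1 * c.1 * hb + b.1 * hc
    rw [key]
    linear_combination (1 - b.1 * c.1) * (1 - b.1 * c.1) * ha + (1 - a.1) * hbc
  top := ⟨1, .one A⟩
  le_top a := mul_one a.1
  bot := ⟨0, .zero A⟩
  bot_le a := zero_mul a.1
  compl a := ⟨1 - a.1, a.2.one_sub⟩
  inf_compl_le_bot a := by
    change a.1 * (1 - a.1) * 0 = a.1 * (1 - a.1)
    rw [mul_zero, a.2.mul_one_sub_self]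
  top_le_sup_compl a := by
    change 1 * (a.1 + (1 - a.1) - a.1 * (1 - a.1)) = 1
    rw [a.2.mul_one_sub_self]
    ring

end ProjAlg

/-- `ν : L → ℂ` is a complex valuation on the distributive lattice `L` with least element. -/
structure IsComplexValuation {L : Type*} [DistribLattice L] [OrderBot L] (ν : L → ℂ) : Prop where
  map_bot : ν ⊥ = 0
  map_add_map : ∀ x y : L, ν x + ν y = ν (x ⊔ y) + ν (x ⊓ y)

/-- A complex valuation is continuous if it sends the supremum of a (nonempty) directed subset `I`,
whenever that supremum exists, to the limit of its values along `I`. -/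
structure IsContinuousComplexValuation {L : Type*} [DistribLattice L] [OrderBot L] (ν : L → ℂ) :
    Prop extends IsComplexValuation ν where
  tendsto_of_isLUB : ∀ (I : Set L) (s : L), I.Nonempty → DirectedOn (· ≤ ·) I → IsLUB I s →
    Tendsto (fun x : I => ν x) atTop (𝓝 (ν s))

/-- The vector space of complex continuous valuations on `L`. -/
def continuousComplexValuations (L : Type*) [DistribLattice L] [OrderBot L] :
    Submodule ℂ (L → ℂ) where
  carrier := {ν | IsContinuousComplexValuation ν}
  add_mem' {μ ν} hμ hν :=
    { map_bot := by simp [hμ.map_bot, hν.map_bot]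
      map_add_map := fun x y => by
        simp only [Pi.add_apply]
        linear_combination hμ.map_add_map x y + hν.map_add_map x y
      tendsto_of_isLUB := fun I s hne hd hs =>
        (hμ.tendsto_of_isLUB I s hne hd hs).add (hν.tendsto_of_isLUB I s hne hd hs) }
  zero_mem' :=
    { map_bot := rfl
      map_add_map := fun x y => by simp
      tendsto_of_isLUB := fun I s _ _ _ => tendsto_const_nhds }
  smul_mem' c ν hν :=
    { map_bot := by simp [hν.map_bot]
      map_add_map := fun x y => by
        simp only [Pi.smul_apply, smul_eq_mul]
        linear_combination c * hν.map_add_map x y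
      tendsto_of_isLUB := fun I s hne hd hs => (hν.tendsto_of_isLUB I s hne hd hs).const_smul c }

/-- Given an isometric isomorphism `e` of `A` with the dual of `X`, an element `μ` of `X` is regarded
as the functional `a ↦ e a μ` on `A`; this is the canonical map from the predual to the dual. -/
noncomputable def predualToDual {A X : Type*} [CommCStarAlgebra A] [NormedAddCommGroup X]
    [NormedSpace ℂ X] (e : A ≃ₗᵢ[ℂ] StrongDual ℂ X) : X →L[ℂ] StrongDual ℂ A :=
  ContinuousLinearMap.flip (e : A →L[ℂ] StrongDual ℂ X)

/-- The restriction of the elements of the predual `X` of `A` to the projections of `A`. -/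
noncomputable def predualRestrict {A X : Type*} [CommCStarAlgebra A] [NormedAddCommGroup X]
    [NormedSpace ℂ X] (e : A ≃ₗᵢ[ℂ] StrongDual ℂ X) : X →ₗ[ℂ] (ProjAlg A → ℂ) where
  toFun μ p := predualToDual e μ p.1
  map_add' μ ν := by ext p; simp
  map_smul' c μ := by ext p; simp

/-! Projections are tied to the predual by weak-* compactness. The set of elements between `0` and
`1` is weak-* compact and convex, and its extreme points are projections. Krein–Milman therefore
bounds a predual element by its values on projections (`predual_norm_le`). This gives injectivity,
and it makes the valuations coming from the predual closed under uniform limits. A weak-* limit of a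
directed family of projections is again a projection and is the supremum of the family. Hence
directed suprema exist and predual elements restrict to continuous valuations.

Surjectivity is a Radon–Nikodym argument without measure spaces. Real and imaginary parts reduce it
to real valuations, and the Hahn decomposition `exists_hahn` reduces these to positive ones. A
positive valuation dominated by a representable one is a uniform limit of dyadic sums of cut-offs of
the latter (`isRepresentable_of_le`). An exhaustion argument handles the general positive case
(`isRepresentable_of_nonneg`).

Cutting off by a projection and taking real parts must stay inside the predual, that is,
multiplication by a projection and the involution must be weak-* continuous on the unit ball. Their
graphs are described by norm inequalities, hence weak-* closed, and compactness of the ball yields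
continuity. A functional continuous on the ball is then an evaluation
(`WeakDual.exists_eq_eval_of_continuousOn_closedBall`). -/

/-! ### Real valuations and the Hahn decomposition -/

/-- Real-valued continuous valuations on a distributive lattice with least element. -/
structure IsContinuousRealValuation {L : Type*} [DistribLattice L] [OrderBot L] (ν : L → ℝ) :
    Prop where
  map_bot : ν ⊥ = 0
  map_add_map : ∀ x y : L, ν x + ν y = ν (x ⊔ y) + ν (x ⊓ y)
  tendsto_of_isLUB : ∀ (I : Set L) (s : L), I.Nonempty → DirectedOn (· ≤ ·) I → IsLUB I s →
    Tendsto (fun x : I => ν x) atTop (𝓝 (ν s))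

theorem DirectedOn.atTop_neBot {L : Type*} [Preorder L] {I : Set L} (hne : I.Nonempty)
    (hd : DirectedOn (· ≤ ·) I) : (atTop : Filter I).NeBot := by
  have : Nonempty I := hne.to_subtype
  have : IsDirectedOrder I := directedOn_iff_isDirectedOrder.1 hd
  infer_instance

theorem DirectedOn.inf_image {L : Type*} [DistribLattice L] {I : Set L}
    (hd : DirectedOn (· ≤ ·) I) (p : L) : DirectedOn (· ≤ ·) ((p ⊓ ·) '' I) := by
  rintro _ ⟨x, hx, rfl⟩ _ ⟨y, hy, rfl⟩
  obtain ⟨z, hz, hxz, hyz⟩ := hd x hx y hy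
  exact ⟨p ⊓ z, ⟨z, hz, rfl⟩, inf_le_inf_left p hxz, inf_le_inf_left p hyz⟩

theorem IsLUB.inf_image {B : Type*} [BooleanAlgebra B] {I : Set B} {s : B} (hs : IsLUB I s)
    (p : B) : IsLUB ((p ⊓ ·) '' I) (p ⊓ s) :=
  (gc_inf_himp (a := p)).isLUB_l_image hs

namespace IsContinuousRealValuation

section Lattice

variable {L : Type*} [DistribLattice L] [OrderBot L] {ν ν' : L → ℝ}

theorem sub (hν : IsContinuousRealValuation ν) (hν' : IsContinuousRealValuation ν') :
    IsContinuousRealValuation (fun x => ν x - ν' x) where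
  map_bot := by simp [hν.map_bot, hν'.map_bot]
  map_add_map x y := by linear_combination hν.map_add_map x y - hν'.map_add_map x y
  tendsto_of_isLUB I s hne hd hs :=
    (hν.tendsto_of_isLUB I s hne hd hs).sub (hν'.tendsto_of_isLUB I s hne hd hs)

theorem const_mul (hν : IsContinuousRealValuation ν) (c : ℝ) :
    IsContinuousRealValuation (fun x => c * ν x) where
  map_bot := by simp [hν.map_bot]
  map_add_map x y := by linear_combination c * hν.map_add_map x y
  tendsto_of_isLUB I s hne hd hs := (hν.tendsto_of_isLUB I s hne hd hs).const_mul c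

theorem map_sup_of_disjoint (hν : IsContinuousRealValuation ν) {x y : L} (h : Disjoint x y) :
    ν (x ⊔ y) = ν x + ν y := by
  rw [hν.map_add_map, h.eq_bot, hν.map_bot, add_zero]

theorem le_of_isLUB (hν : IsContinuousRealValuation ν) {I : Set L} {s x₀ : L} {c : ℝ}
    (hx₀ : x₀ ∈ I) (hd : DirectedOn (· ≤ ·) I) (hs : IsLUB I s)
    (h : ∀ x ∈ I, x₀ ≤ x → c ≤ ν x) : c ≤ ν s := by
  have := hd.atTop_neBot ⟨x₀, hx₀⟩
  refine ge_of_tendsto (hν.tendsto_of_isLUB I s ⟨x₀, hx₀⟩ hd hs) ?_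
  filter_upwards [eventually_ge_atTop (⟨x₀, hx₀⟩ : I)] with x hx using h x x.2 hx

end Lattice

section Boolean

variable {B : Type*} [BooleanAlgebra B] {ν : B → ℝ}

theorem inf_left (hν : IsContinuousRealValuation ν) (p : B) :
    IsContinuousRealValuation (fun x => ν (p ⊓ x)) where
  map_bot := by simp [hν.map_bot]
  map_add_map x y := by
    rw [hν.map_add_map, inf_sup_left, ← inf_inf_distrib_left]
  tendsto_of_isLUB I s hne hd hs := by
    have h := hν.tendsto_of_isLUB _ _ (hne.image (p ⊓ ·)) (hd.inf_image p) (hs.inf_image p)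
    rw [Metric.tendsto_nhds] at h ⊢
    intro ε hε
    have := (hd.inf_image p).atTop_neBot (hne.image (p ⊓ ·))
    have : Nonempty I := hne.to_subtype
    have : IsDirectedOrder I := directedOn_iff_isDirectedOrder.1 hd
    have : Nonempty ((p ⊓ ·) '' I) := (hne.image (p ⊓ ·)).to_subtype
    have : IsDirectedOrder ((p ⊓ ·) '' I) := directedOn_iff_isDirectedOrder.1 (hd.inf_image p)
    obtain ⟨⟨_, x₀, hx₀, rfl⟩, h₀⟩ := eventually_atTop.1 (h ε hε)
    exact eventually_atTop.2 ⟨⟨x₀, hx₀⟩, fun x hx =>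
      h₀ ⟨p ⊓ x, x, x.2, rfl⟩ (inf_le_inf_left p hx : p ⊓ x₀ ≤ p ⊓ (x : B))⟩

theorem map_inf_add_map_sdiff (hν : IsContinuousRealValuation ν) (x p : B) :
    ν (x ⊓ p) + ν (x \ p) = ν x := by
  rw [← hν.map_sup_of_disjoint disjoint_inf_sdiff, sup_inf_sdiff]

/-- An exhaustion step for the Hahn decomposition: once a maximal nonpositive piece `m` is removed
from `q`, any remaining nonzero piece of nonpositive value could be joined to `m`. -/
theorem exists_le_forall_pos (hν : IsContinuousRealValuation ν)
    (hB : ∀ I : Set B, I.Nonempty → DirectedOn (· ≤ ·) I → ∃ s, IsLUB I s) (q : B) :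
    ∃ m ≤ q, ν m ≤ 0 ∧ ∀ r ≤ q \ m, r ≠ ⊥ → 0 < ν r := by
  -- Zorn's lemma for the relation "larger element, smaller value". The value has to decrease along
  -- chains so that, by continuity, the supremum of a chain bounds it in both respects.
  obtain ⟨⟨m, hmq, hm⟩, hmax⟩ := exists_maximal_of_chains_bounded
    (r := fun x y : {x : B // x ≤ q ∧ ν x ≤ 0} => x.1 ≤ y.1 ∧ ν y ≤ ν x) (by
      intro c hc
      rcases c.eq_empty_or_nonempty with rfl | hne
      · exact ⟨⟨⊥, bot_le, hν.map_bot.le⟩, by simp⟩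
      have hd : DirectedOn (· ≤ ·) (Subtype.val '' c) := by
        rintro _ ⟨x, hx, rfl⟩ _ ⟨y, hy, rfl⟩
        rcases eq_or_ne x y with rfl | hxy
        · exact ⟨x, ⟨x, hx, rfl⟩, le_rfl, le_rfl⟩
        rcases hc hx hy hxy with h | h
        · exact ⟨y, ⟨y, hy, rfl⟩, h.1, le_rfl⟩
        · exact ⟨x, ⟨x, hx, rfl⟩, le_rfl, h.1⟩
      obtain ⟨s, hs⟩ := hB _ (hne.image _) hd
      have key : ∀ x ∈ c, ν s ≤ ν x := by
        intro x hx
        have h := (hν.const_mul (-1)).le_of_isLUB (c := -1 * ν x) (Set.mem_image_of_mem _ hx)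
          hd hs (by
            rintro _ ⟨y, hy, rfl⟩ hxy
            rcases eq_or_ne x y with rfl | hne'
            · exact le_rfl
            rcases hc hx hy hne' with h | h
            · linarith [h.2]
            · rw [le_antisymm hxy h.1])
        linarith
      obtain ⟨x₀, hx₀⟩ := hne
      refine ⟨⟨s, hs.2 ?_, (key x₀ hx₀).trans x₀.2.2⟩, fun x hx => ⟨hs.1 ⟨x, hx, rfl⟩, key x hx⟩⟩
      rintro _ ⟨y, -, rfl⟩
      exact y.2.1) (fun h h' => ⟨h.1.trans h'.1, h'.2.trans h.2⟩)
  refine ⟨m, hmq, hm, fun r hr hr0 => ?_⟩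
  by_contra! hneg
  have hdis : Disjoint m r := disjoint_sdiff_self_right.mono_right hr
  have hval := hν.map_sup_of_disjoint hdis
  have h := hmax ⟨m ⊔ r, sup_le hmq (hr.trans sdiff_le), by linarith⟩
    ⟨le_sup_left, show ν (m ⊔ r) ≤ ν m by linarith⟩
  exact hr0 (hdis.symm.eq_bot_of_le (le_sup_right.trans h.1))

/-- **Hahn decomposition** for real continuous valuations. -/
theorem exists_hahn (hν : IsContinuousRealValuation ν)
    (hB : ∀ I : Set B, I.Nonempty → DirectedOn (· ≤ ·) I → ∃ s, IsLUB I s) :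
    ∃ p : B, (∀ r ≤ p, 0 ≤ ν r) ∧ ∀ r, Disjoint r p → ν r ≤ 0 := by
  have hne : {x : B | ∀ r ≤ x, 0 ≤ ν r}.Nonempty :=
    ⟨⊥, fun r hr => by rw [le_bot_iff.1 hr, hν.map_bot]⟩
  have hd : DirectedOn (· ≤ ·) {x : B | ∀ r ≤ x, 0 ≤ ν r} := by
    refine fun x hx y hy => ⟨x ⊔ y, fun r hr => ?_, le_sup_left, le_sup_right⟩
    rw [← hν.map_inf_add_map_sdiff r x]
    exact add_nonneg (hx _ inf_le_right) (hy _ (sdiff_le_iff.2 hr))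
  obtain ⟨p, hp⟩ := hB _ hne hd
  refine ⟨p, fun r hr => ?_, fun r hr => ?_⟩
  · obtain ⟨x₀, hx₀⟩ := hne
    have h := (hν.inf_left r).le_of_isLUB (c := 0) hx₀ hd hp fun x hx _ => hx _ inf_le_right
    rwa [inf_eq_left.2 hr] at h
  -- Everything below `r \ m` is nonnegative, so `r \ m` lies under `p`; being disjoint from `p` it
  -- vanishes, and `r = m` has nonpositive value.
  · obtain ⟨m, hmr, hm, hpos⟩ := hν.exists_le_forall_pos hB r
    have hle : r \ m ≤ p := hp.1 fun t ht => by
      rcases eq_or_ne t ⊥ with rfl | h0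
      · exact hν.map_bot.ge
      · exact (hpos t ht h0).le
    have h0 : r \ m = ⊥ := (hr.mono_left sdiff_le).eq_bot_of_le hle
    rwa [le_antisymm (sdiff_eq_bot_iff.1 h0) hmr]

end Boolean

end IsContinuousRealValuation

/-! ### The weak-* topology of a dual space -/

/-- A linear functional on the dual of a Banach space which is weak-* continuous on the unit ball is
the evaluation at a vector. -/
theorem WeakDual.exists_eq_eval_of_continuousOn_closedBall {X : Type*} [NormedAddCommGroup X]
    [NormedSpace ℂ X] [CompleteSpace X] (f : StrongDual ℂ X →ₗ[ℂ] ℂ)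
    (hf : ContinuousOn (fun x : WeakDual ℂ X => f (WeakDual.toStrongDual x))
      (WeakDual.toStrongDual ⁻¹' Metric.closedBall 0 1)) :
    ∃ μ : X, ∀ x, f x = x μ := by
  obtain ⟨C, hC⟩ :=
    (WeakDual.isCompact_closedBall (0 : StrongDual ℂ X) 1).exists_bound_of_continuousOn hf
  have bound : ∀ {c : ℝ} (g : StrongDual ℂ X →ₗ[ℂ] ℂ) (N : Submodule ℂ (StrongDual ℂ X)),
      (∀ x ∈ N, ‖x‖ ≤ 1 → ‖g x‖ ≤ c) → ∀ x ∈ N, ‖g x‖ ≤ c * ‖x‖ := by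
    intro c g N h x hx
    rcases eq_or_ne x 0 with rfl | hx0
    · simp
    have hpos : 0 < ‖x‖ := norm_pos_iff.2 hx0
    have := h (((‖x‖ : ℂ)⁻¹) • x) (N.smul_mem _ hx) (by
      simp [norm_smul, hpos.ne'])
    rw [map_smul, norm_smul] at this
    simp only [norm_inv, Complex.norm_real, norm_norm] at this
    rwa [inv_mul_le_iff₀ hpos, mul_comm] at this
  let F : StrongDual ℂ (StrongDual ℂ X) := f.mkContinuous C fun x =>
    bound f ⊤ (fun x _ hx => hC (StrongDual.toWeakDual x) (by simpa using! hx)) x trivial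
  -- As `X` is complete, its image in the bidual is norm closed, so it suffices to approximate `F`
  -- in norm by evaluations.
  have hclosed : IsClosed (Set.range (NormedSpace.inclusionInDoubleDualLi ℂ (E := X))) :=
    (NormedSpace.inclusionInDoubleDualLi ℂ (E := X)).isometry.isUniformInducing.isComplete_range.isClosed
  have hmem : F ∈ Set.range (NormedSpace.inclusionInDoubleDualLi ℂ (E := X)) := by
    refine hclosed.closure_subset ((Metric.mem_closure_iff (α := StrongDual ℂ (StrongDual ℂ X))).2 ?_)
    intro ε hε
    have h0 := hf 0 (by simp)
    have h1 : {x : WeakDual ℂ X | ‖f (WeakDual.toStrongDual x)‖ < ε / 2} ∈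
        𝓝[WeakDual.toStrongDual ⁻¹' Metric.closedBall 0 1] (0 : WeakDual ℂ X) := by
      refine h0.norm (Iio_mem_nhds ?_)
      simpa using hε
    obtain ⟨U, hU, hUf⟩ := mem_nhdsWithin_iff_exists_mem_nhds_inter.1 h1
    obtain ⟨s, r, hr, hball⟩ := ((WeakDual.withSeminorms (𝕜 := ℂ) (E := X)).mem_nhds_iff _ _).1 hU
    let ev : s → StrongDual ℂ X →ₗ[ℂ] ℂ := fun i =>
      (NormedSpace.inclusionInDoubleDual ℂ X i.1 : StrongDual ℂ X →ₗ[ℂ] ℂ)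
    let N : Submodule ℂ (StrongDual ℂ X) := ⨅ i, LinearMap.ker (ev i)
    have hN : ∀ x ∈ N, ∀ i ∈ s, x i = 0 := by
      intro x hx i hi
      exact (Submodule.mem_iInf _).1 hx ⟨i, hi⟩
    have hfN : ∀ x ∈ N, ‖x‖ ≤ 1 → ‖f x‖ ≤ ε / 2 := by
      intro x hx hx1
      refine (hUf (a := StrongDual.toWeakDual x) ⟨hball ?_, by simpa using! hx1⟩).le
      rw [Seminorm.mem_ball_zero]
      refine Seminorm.finset_sup_apply_lt hr fun i hi => ?_
      rw [WeakDual.seminormFamily_apply]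
      have : (StrongDual.toWeakDual x) i = 0 := hN x hx i hi
      rwa [this, norm_zero]
    -- On `N`, the common kernel of finitely many evaluations, `F` has norm at most `ε / 2`. A
    -- Hahn–Banach extension `g` of this restriction keeps that norm, and `F - g` vanishes on `N`,
    -- hence is a combination of those evaluations.
    obtain ⟨g, hg, hgn⟩ := exists_extension_norm_eq N (F.comp N.subtypeL)
    have hspan : ((F - g : StrongDual ℂ (StrongDual ℂ X)) : StrongDual ℂ X →ₗ[ℂ] ℂ) ∈
        Submodule.span ℂ (Set.range ev) := by
      refine mem_span_of_iInf_ker_le_ker fun x hx => ?_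
      have := hg ⟨x, hx⟩
      simp only [ContinuousLinearMap.comp_apply, Submodule.subtypeL_apply] at this
      simp [this]
    have hrange : Submodule.span ℂ (Set.range ev) ≤ LinearMap.range
        ((ContinuousLinearMap.coeLM ℂ).comp (NormedSpace.inclusionInDoubleDual ℂ X : X →ₗ[ℂ] _)) := by
      rw [Submodule.span_le]
      rintro _ ⟨i, rfl⟩
      exact ⟨i, rfl⟩
    obtain ⟨μ, hμ⟩ := hrange hspan
    refine ⟨_, ⟨μ, rfl⟩, ?_⟩
    have hFg : F - NormedSpace.inclusionInDoubleDualLi ℂ μ = g := by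
      ext x
      have := LinearMap.congr_fun hμ x
      change x μ = F x - g x at this
      change F x - x μ = g x
      rw [this]; ring
    refine (dist_eq_norm (E := StrongDual ℂ (StrongDual ℂ X)) _ _).trans_lt ?_
    rw [hFg, hgn]
    refine (ContinuousLinearMap.opNorm_le_bound _ (half_pos hε).le fun x => ?_).trans_lt
      (half_lt_self hε)
    exact bound f N hfN x x.2
  obtain ⟨μ, hμ⟩ := hmem
  exact ⟨μ, fun x => (DFunLike.congr_fun hμ x).symm⟩

theorem WeakDual.isScalarTower_real (X : Type*) [NormedAddCommGroup X] [NormedSpace ℂ X] :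
    IsScalarTower ℝ ℂ (WeakDual ℂ X) where
  smul_assoc r z x := by
    apply DFunLike.ext
    intro y
    change ((r • z) • x y : ℂ) = r • (z • x y)
    rw [smul_assoc]

theorem WeakDual.locallyConvexSpace_real (X : Type*) [NormedAddCommGroup X] [NormedSpace ℂ X] :
    LocallyConvexSpace ℝ (WeakDual ℂ X) := by
  have := WeakDual.isScalarTower_real X
  exact (WeakDual.withSeminorms (𝕜 := ℂ) (E := X)).toLocallyConvexSpace

theorem WeakDual.closure_convexHull_extremePoints_eq {X : Type*} [NormedAddCommGroup X]
    [NormedSpace ℂ X] {s : Set (WeakDual ℂ X)} (hs : IsCompact s) (hc : Convex ℝ s) :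
    closure (convexHull ℝ (s.extremePoints ℝ)) = s := by
  have := WeakDual.locallyConvexSpace_real X
  exact closure_convexHull_extremePoints hs hc

theorem WeakDual.convex_norm_apply_le {X : Type*} [NormedAddCommGroup X] [NormedSpace ℂ X]
    (μ : X) (M : ℝ) : Convex ℝ {x : WeakDual ℂ X | ‖x μ‖ ≤ M} := by
  intro x hx y hy s t hs ht hst
  have hx : ‖x μ‖ ≤ M := hx
  have hy : ‖y μ‖ ≤ M := hy
  change ‖(s : ℂ) * x μ + (t : ℂ) * y μ‖ ≤ M
  refine (norm_add_le _ _).trans ?_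
  rw [norm_mul, norm_mul, Complex.norm_real, Complex.norm_real, Real.norm_of_nonneg hs,
    Real.norm_of_nonneg ht]
  calc s * ‖x μ‖ + t * ‖y μ‖ ≤ s * M + t * M := by gcongr
    _ = M := by rw [← add_mul, hst, one_mul]

/-- A bound for an evaluation on the extreme points of a weak-* compact convex set holds on the
whole set. -/
theorem WeakDual.norm_apply_le_of_extremePoints {X : Type*} [NormedAddCommGroup X]
    [NormedSpace ℂ X] {s : Set (WeakDual ℂ X)} (hs : IsCompact s) (hc : Convex ℝ s) {μ : X} {M : ℝ}
    (h : ∀ x ∈ s.extremePoints ℝ, ‖x μ‖ ≤ M) {x : WeakDual ℂ X} (hx : x ∈ s) : ‖x μ‖ ≤ M := by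
  have hclosed : IsClosed {x : WeakDual ℂ X | ‖x μ‖ ≤ M} :=
    isClosed_le (WeakDual.eval_continuous μ).norm continuous_const
  have hsub : convexHull ℝ (s.extremePoints ℝ) ⊆ {x : WeakDual ℂ X | ‖x μ‖ ≤ M} :=
    convexHull_min h (WeakDual.convex_norm_apply_le μ M)
  rw [← WeakDual.closure_convexHull_extremePoints_eq hs hc] at hx
  exact hclosed.closure_subset_iff.2 hsub hx

/-! ### Criteria by closed graphs and by norm inequalities -/

/-- A map into a compact space is continuous on `K` if its graph over `K` is cut out by a closed
relation. -/
theorem IsCompact.continuousOn_of_isClosed_graph {α β : Type*} [TopologicalSpace α]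
    [TopologicalSpace β] {K : Set α} {K' : Set β} {T : α → β} {G : Set (α × β)}
    (hK' : IsCompact K') (hT : Set.MapsTo T K K') (hG : IsClosed G)
    (hTG : ∀ x ∈ K, (x, T x) ∈ G) (hGT : ∀ x ∈ K, ∀ y ∈ K', (x, y) ∈ G → y = T x) :
    ContinuousOn T K := by
  intro x hx
  rw [ContinuousWithinAt, tendsto_iff_ultrafilter]
  intro U hU
  have hUK : K ∈ U := hU self_mem_nhdsWithin
  obtain ⟨y, hy, hUy⟩ := hK'.ultrafilter_le_nhds (U.map T)
    (le_principal_iff.2 (mem_map.2 (mem_of_superset hUK hT)))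
  have hxy : (x, y) ∈ G := hG.mem_of_tendsto
    ((show Tendsto id (U : Filter α) (𝓝 x) from hU.trans nhdsWithin_le_nhds).prodMk_nhds
      (show Tendsto T U (𝓝 y) from hUy)) (mem_of_superset hUK hTG)
  rw [← hGT x hx y hy hxy]
  exact hUy

theorem Complex.im_eq_zero_and_norm_le_one_iff (w : ℂ) :
    (w.im = 0 ∧ ‖w‖ ≤ 1) ↔ ∀ t : ℝ, ‖w + t * Complex.I‖ ≤ √(1 + t ^ 2) := by
  have key : ∀ t : ℝ, ‖w + t * Complex.I‖ ≤ √(1 + t ^ 2) ↔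
      w.re ^ 2 + (w.im + t) ^ 2 ≤ 1 + t ^ 2 := by
    intro t
    rw [Real.le_sqrt (norm_nonneg _) (by positivity), Complex.sq_norm, Complex.normSq_apply]
    simp [sq]
  simp_rw [key]
  have hn : ‖w‖ ≤ 1 ↔ w.re ^ 2 + w.im ^ 2 ≤ 1 := by
    rw [← sq_le_one_iff₀ (norm_nonneg _), Complex.sq_norm, Complex.normSq_apply, sq, sq]
  rw [hn]
  constructor
  · rintro ⟨h0, h1⟩ t
    rw [h0] at h1 ⊢
    linarith
  · intro h
    have h0 := h 0
    refine ⟨?_, by linarith⟩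
    by_contra him
    -- The inequality expands to `|w|² + 2 t w.im ≤ 1`; this `t` makes the middle term equal to `2`.
    have := h (1 / w.im)
    have h2 : w.im * (1 / w.im) = 1 := by field_simp
    nlinarith [sq_nonneg w.re, sq_nonneg w.im]

/-! ### Order and norm through characters -/

namespace CommCStarAlgebra

open WeakDual

variable {A : Type*} [CommCStarAlgebra A]

theorem norm_le_iff_character {a : A} {r : ℝ} (hr : 0 ≤ r) :
    ‖a‖ ≤ r ↔ ∀ χ : characterSpace ℂ A, ‖χ a‖ ≤ r := by
  rw [← (gelfandTransform_isometry A).norm_map_of_map_zero (map_zero _), ContinuousMap.norm_le _ hr]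
  rfl

theorem ext_character {a b : A} (h : ∀ χ : characterSpace ℂ A, χ a = χ b) : a = b :=
  (gelfandTransform_isometry A).injective (ContinuousMap.ext h)

theorem character_star (χ : characterSpace ℂ A) (a : A) : χ (star a) = star (χ a) :=
  map_star χ a

theorem norm_character_le (χ : characterSpace ℂ A) (a : A) : ‖χ a‖ ≤ ‖a‖ :=
  (norm_le_iff_character (norm_nonneg a)).1 le_rfl χ

variable (A) in
/-- The self-adjoint elements of norm at most one. -/
def realUnitBall : Set A := {a | ∀ χ : characterSpace ℂ A, (χ a).im = 0 ∧ ‖χ a‖ ≤ 1}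

variable (A) in
/-- The elements between `0` and `1`. -/
def effects : Set A :=
  {a | ∀ χ : characterSpace ℂ A, (χ a).im = 0 ∧ 0 ≤ (χ a).re ∧ (χ a).re ≤ 1}

/-- Self-adjointness is rewritten as membership in a family of translated balls, because closed
balls are weak-* closed while continuity of the involution is not yet available. -/
theorem mem_realUnitBall_iff {a : A} :
    a ∈ realUnitBall A ↔ ∀ t : ℝ, ‖a + ((t : ℂ) * Complex.I) • (1 : A)‖ ≤ √(1 + t ^ 2) := by
  simp only [realUnitBall, Set.mem_ofPred_eq, Complex.im_eq_zero_and_norm_le_one_iff]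
  rw [forall_comm]
  refine forall_congr' fun t => ?_
  rw [norm_le_iff_character (Real.sqrt_nonneg _)]
  simp

theorem mem_effects_iff {a : A} : a ∈ effects A ↔ (2 : ℂ) • a - 1 ∈ realUnitBall A := by
  refine forall_congr' fun χ => ?_
  have h : χ ((2 : ℂ) • a - 1) = 2 * χ a - 1 := by simp
  rw [h]
  have him : (2 * χ a - 1).im = 2 * (χ a).im := by simp
  have hre : (2 * χ a - 1).re = 2 * (χ a).re - 1 := by simp
  rw [him]
  constructor
  · rintro ⟨h0, h1, h2⟩
    refine ⟨by rw [h0, mul_zero], ?_⟩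
    rw [← Complex.abs_re_eq_norm.2 (by rw [him, h0, mul_zero]), hre, abs_le]
    constructor <;> linarith
  · rintro ⟨h0, h1⟩
    have := abs_le.1 ((Complex.abs_re_le_norm _).trans h1)
    rw [hre] at this
    exact ⟨by linarith, by linarith, by linarith⟩

theorem norm_le_one_of_mem_effects {a : A} (ha : a ∈ effects A) : ‖a‖ ≤ 1 := by
  refine (norm_le_iff_character zero_le_one).2 fun χ => ?_
  rw [← Complex.abs_re_eq_norm.2 (ha χ).1, abs_of_nonneg (ha χ).2.1]
  exact (ha χ).2.2

theorem character_eq_re {a : A} (ha : a ∈ effects A) (χ : characterSpace ℂ A) :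
    χ a = ((χ a).re : ℂ) :=
  Complex.ext rfl (by simp [(ha χ).1])

theorem mem_effects_of_character_eq {a : A} (f : characterSpace ℂ A → ℝ)
    (h : ∀ χ : characterSpace ℂ A, χ a = f χ ∧ 0 ≤ f χ ∧ f χ ≤ 1) : a ∈ effects A := by
  intro χ
  rw [(h χ).1]
  simpa using (h χ).2

theorem character_proj {p : A} (hp : IsStarProjection p) (χ : characterSpace ℂ A) :
    χ p = 0 ∨ χ p = 1 := by
  have h : χ p * χ p = χ p := by rw [← map_mul, hp.isIdempotentElem.eq]
  have h' : χ p * (χ p - 1) = 0 := by linear_combination h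
  rcases mul_eq_zero.1 h' with h | h
  · exact Or.inl h
  · exact Or.inr (sub_eq_zero.1 h)

theorem isStarProjection_of_mem_effects {a : A} (ha : a ∈ effects A) (h : a * a = a) :
    IsStarProjection a := by
  refine ⟨h, ext_character fun χ => ?_⟩
  rw [character_star, Complex.star_def, Complex.conj_eq_iff_im.2 (ha χ).1]

theorem sub_mem_effects_iff {p q : A} (hp : IsStarProjection p) (hq : IsStarProjection q) :
    q - p ∈ effects A ↔ p * q = p := by
  constructor
  · refine fun h => ext_character fun χ => ?_
    have := (h χ).2.1
    rw [map_sub] at this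
    rw [map_mul]
    rcases character_proj hp χ with h1 | h1 <;> rcases character_proj hq χ with h2 | h2 <;>
      first | (norm_num [h1, h2]; done) | (norm_num [h1, h2] at this)
  · intro h χ
    have h' : χ p * χ q = χ p := by rw [← map_mul, h]
    rw [map_sub]
    rcases character_proj hp χ with h1 | h1 <;> rcases character_proj hq χ with h2 | h2 <;>
      first | (norm_num [h1, h2]; done) | (norm_num [h1, h2] at h')

/-- Where a character sends `p` to `1`, a nonzero value of `a` could be pushed outside the unit disc
by adding a unit number of the same argument. Together with `norm_add_smul_le_one` this describes by
norms which elements of the unit ball are killed by `p`. -/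
theorem mul_eq_zero_of_forall_norm_le {p a : A} (hp : IsStarProjection p)
    (h : ∀ z : ℂ, ‖z‖ ≤ 1 → ‖a + z • p‖ ≤ 1) : p * a = 0 := by
  refine ext_character fun χ => ?_
  rw [map_mul, map_zero]
  rcases character_proj hp χ with h1 | h1
  · rw [h1, zero_mul]
  rw [h1, one_mul]
  by_contra hne
  have hn : 0 < ‖χ a‖ := norm_pos_iff.2 hne
  have hz : ‖χ a / (‖χ a‖ : ℂ)‖ = 1 := by simp [hn.ne']
  have := (norm_character_le χ _).trans (h _ hz.le)
  rw [map_add, map_smul, h1, smul_eq_mul, mul_one] at this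
  have heq : χ a + χ a / (‖χ a‖ : ℂ) = ((‖χ a‖ + 1 : ℝ) : ℂ) * (χ a / (‖χ a‖ : ℂ)) := by
    have : (‖χ a‖ : ℂ) ≠ 0 := by exact_mod_cast hn.ne'
    push_cast
    field_simp
  rw [heq, norm_mul, hz, mul_one, Complex.norm_real, Real.norm_of_nonneg (by positivity)] at this
  linarith

theorem norm_add_smul_le_one {p a : A} (hp : IsStarProjection p) (ha : ‖a‖ ≤ 1) {z : ℂ}
    (hz : ‖z‖ ≤ 1) : ‖(1 - p) * a + z • p‖ ≤ 1 := by
  refine (norm_le_iff_character zero_le_one).2 fun χ => ?_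
  have := (norm_character_le χ a).trans ha
  rcases character_proj hp χ with h1 | h1 <;> simp [h1, hz, this]

end CommCStarAlgebra

/-! ### Weak-* compactness and the norm bound from projections -/

namespace CommCStarAlgebra

open WeakDual

variable {A X : Type*} [CommCStarAlgebra A] [NormedAddCommGroup X] [NormedSpace ℂ X]
  (e : A ≃ₗᵢ[ℂ] StrongDual ℂ X)

/-- The algebra, identified with the dual of its predual in the weak-* topology. -/
noncomputable def ofWeakDual : WeakDual ℂ X ≃ₗ[ℂ] A :=
  WeakDual.toStrongDual.trans e.symm.toLinearEquiv

theorem apply_ofWeakDual (x : WeakDual ℂ X) (μ : X) : e (ofWeakDual e x) μ = x μ :=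
  DFunLike.congr_fun (e.apply_symm_apply (WeakDual.toStrongDual x)) μ

theorem ofWeakDual_symm_apply (a : A) (μ : X) : (ofWeakDual e).symm a μ = e a μ := rfl

theorem norm_ofWeakDual (x : WeakDual ℂ X) : ‖ofWeakDual e x‖ = ‖WeakDual.toStrongDual x‖ :=
  e.symm.norm_map _

theorem isClosed_norm_ofWeakDual_add_le (b : A) (r : ℝ) :
    IsClosed {x : WeakDual ℂ X | ‖ofWeakDual e x + b‖ ≤ r} := by
  convert! WeakDual.isClosed_closedBall (-(e b)) r using 1
  ext x
  have : e (ofWeakDual e x + b) = WeakDual.toStrongDual x - -(e b) := by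
    rw [map_add, sub_neg_eq_add]
    congr 1
    exact e.apply_symm_apply _
  change ‖_‖ ≤ r ↔ dist (WeakDual.toStrongDual x) (-(e b)) ≤ r
  rw [← e.norm_map, this]
  exact Iff.of_eq (congrArg (· ≤ r) (dist_eq_norm (E := StrongDual ℂ X) _ _).symm)

theorem preimage_ofWeakDual_closedBall :
    (ofWeakDual e) ⁻¹' Metric.closedBall 0 1 =
      WeakDual.toStrongDual ⁻¹' Metric.closedBall (0 : StrongDual ℂ X) 1 := by
  ext x
  rw [Set.mem_preimage, mem_closedBall_zero_iff, norm_ofWeakDual]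
  exact mem_closedBall_zero_iff.symm

theorem isCompact_preimage_closedBall :
    IsCompact ((ofWeakDual e) ⁻¹' Metric.closedBall 0 1) := by
  rw [preimage_ofWeakDual_closedBall]
  exact WeakDual.isCompact_closedBall _ _

theorem isClosed_preimage_realUnitBall : IsClosed (ofWeakDual e ⁻¹' realUnitBall A) := by
  have : ofWeakDual e ⁻¹' realUnitBall A = ⋂ t : ℝ,
      {x | ‖ofWeakDual e x + ((t : ℂ) * Complex.I) • (1 : A)‖ ≤ √(1 + t ^ 2)} := by
    ext x
    rw [Set.mem_preimage, mem_realUnitBall_iff, Set.mem_iInter]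
    rfl
  rw [this]
  exact isClosed_iInter fun t => isClosed_norm_ofWeakDual_add_le e _ _

theorem isCompact_preimage_effects : IsCompact (ofWeakDual e ⁻¹' effects A) := by
  refine (isCompact_preimage_closedBall e).of_isClosed_subset ?_ fun x hx =>
    mem_closedBall_zero_iff.2 (norm_le_one_of_mem_effects hx)
  have : ofWeakDual e ⁻¹' effects A =
      (fun x => (2 : ℂ) • x - (ofWeakDual e).symm 1) ⁻¹' (ofWeakDual e ⁻¹' realUnitBall A) := by
    ext x
    simp [mem_effects_iff]
  rw [this]
  exact (isClosed_preimage_realUnitBall e).preimage (by fun_prop)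

theorem ofWeakDual_real_smul (r : ℝ) (x : WeakDual ℂ X) :
    ofWeakDual e (r • x) = (r : ℂ) • ofWeakDual e x := by
  rw [← map_smul]
  rfl

theorem convex_preimage_effects : Convex ℝ (ofWeakDual e ⁻¹' effects A) := by
  intro x hx y hy s t hs ht hst χ
  obtain ⟨hx0, hx1, hx2⟩ := hx χ
  obtain ⟨hy0, hy1, hy2⟩ := hy χ
  have : χ (ofWeakDual e (s • x + t • y)) =
      (s : ℂ) * χ (ofWeakDual e x) + (t : ℂ) * χ (ofWeakDual e y) := by
    rw [map_add, ofWeakDual_real_smul, ofWeakDual_real_smul, map_add, map_smul, map_smul]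
    rfl
  rw [this]
  simp only [Complex.add_im, Complex.im_ofReal_mul, Complex.add_re, Complex.re_ofReal_mul]
  refine ⟨by rw [hx0, hy0]; ring, by positivity, ?_⟩
  nlinarith

/-- `a` is the midpoint of `a²` and `2a - a²`, which both lie between `0` and `1`; extremality
forces `a² = a`. -/
theorem isStarProjection_of_mem_extremePoints {x : WeakDual ℂ X}
    (hx : x ∈ (ofWeakDual e ⁻¹' effects A).extremePoints ℝ) :
    IsStarProjection (ofWeakDual e x) := by
  obtain ⟨hx, hext⟩ := mem_extremePoints.1 hx
  set a := ofWeakDual e x with ha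
  have h1 : a * a ∈ effects A := mem_effects_of_character_eq (fun χ => (χ a).re ^ 2) fun χ => by
    obtain ⟨-, h0, h1⟩ := hx χ
    refine ⟨?_, by positivity, by nlinarith⟩
    rw [map_mul, character_eq_re hx, Complex.ofReal_re]
    push_cast
    ring
  have h2 : (2 : ℂ) • a - a * a ∈ effects A :=
    mem_effects_of_character_eq (fun χ => 2 * (χ a).re - (χ a).re ^ 2) fun χ => by
      obtain ⟨-, h0, h1⟩ := hx χ
      refine ⟨?_, by nlinarith, by nlinarith [sq_nonneg ((χ a).re - 1)]⟩
      rw [map_sub, map_smul, map_mul, character_eq_re hx, Complex.ofReal_re, smul_eq_mul]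
      push_cast
      ring
  have h := (hext ((ofWeakDual e).symm (a * a)) (by simpa using h1)
    ((ofWeakDual e).symm ((2 : ℂ) • a - a * a)) (by simpa using h2)
    ⟨1 / 2, 1 / 2, by norm_num, by norm_num, by norm_num, by
      apply (ofWeakDual e).injective
      rw [map_add, ofWeakDual_real_smul, ofWeakDual_real_smul, LinearEquiv.apply_symm_apply,
        LinearEquiv.apply_symm_apply, ← smul_add, add_sub_cancel, smul_smul]
      simp [ha]⟩).1
  refine isStarProjection_of_mem_effects hx ?_
  exact ((ofWeakDual e).symm_apply_eq.1 h)

theorem norm_le_of_forall_projAlg {μ : X} {M : ℝ} (h : ∀ p : ProjAlg A, ‖e p.1 μ‖ ≤ M)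
    {a : A} (ha : a ∈ effects A) : ‖e a μ‖ ≤ M := by
  have hext : ∀ x ∈ (ofWeakDual e ⁻¹' effects A).extremePoints ℝ, ‖x μ‖ ≤ M := by
    intro x hx
    have h' := h ⟨_, isStarProjection_of_mem_extremePoints e hx⟩
    rwa [apply_ofWeakDual] at h'
  have hmem : (ofWeakDual e).symm a ∈ ofWeakDual e ⁻¹' effects A := by simpa using ha
  have h' := WeakDual.norm_apply_le_of_extremePoints (isCompact_preimage_effects e)
    (convex_preimage_effects e) hext hmem
  rwa [ofWeakDual_symm_apply] at h'

theorem norm_le_of_mem_realUnitBall {μ : X} {M : ℝ} (h : ∀ p : ProjAlg A, ‖e p.1 μ‖ ≤ M)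
    {a : A} (ha : a ∈ realUnitBall A) : ‖e a μ‖ ≤ 3 * M := by
  have h1 : ((1 / 2 : ℂ)) • (a + 1) ∈ effects A := by
    rw [mem_effects_iff, smul_smul]
    norm_num [ha]
  -- `a` is twice the effect `(a + 1) / 2` minus the projection `1`, whence the factor `2 + 1`.
  have h2 : e a μ = 2 * e ((1 / 2 : ℂ) • (a + 1)) μ - e 1 μ := by
    simp
    ring
  have h3 := norm_le_of_forall_projAlg e h h1
  have h4 : ‖e 1 μ‖ ≤ M := h ⟨1, .one A⟩
  rw [h2]
  refine (norm_sub_le _ _).trans ?_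
  rw [norm_mul, Complex.norm_ofNat]
  linarith

theorem half_add_star_mem_realUnitBall {a : A} (ha : ‖a‖ ≤ 1) :
    (1 / 2 : ℂ) • (a + star a) ∈ realUnitBall A := by
  intro χ
  have h : χ ((1 / 2 : ℂ) • (a + star a)) = ((χ a).re : ℂ) := by
    rw [map_smul, map_add, character_star, Complex.star_def, Complex.add_conj, smul_eq_mul]
    push_cast
    ring
  rw [h]
  refine ⟨by simp, ?_⟩
  rw [Complex.norm_real]
  exact (Complex.abs_re_le_norm _).trans ((norm_character_le χ a).trans ha)

theorem half_sub_star_mem_realUnitBall {a : A} (ha : ‖a‖ ≤ 1) :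
    (-Complex.I / 2) • (a - star a) ∈ realUnitBall A := by
  intro χ
  have h : χ ((-Complex.I / 2) • (a - star a)) = ((χ a).im : ℂ) := by
    rw [map_smul, map_sub, character_star, Complex.star_def, Complex.sub_conj, smul_eq_mul]
    push_cast
    linear_combination (-(χ a).im : ℂ) * Complex.I_mul_I
  rw [h]
  refine ⟨by simp, ?_⟩
  rw [Complex.norm_real]
  exact (Complex.abs_im_le_norm _).trans ((norm_character_le χ a).trans ha)

/-- The norm of an element of the predual is controlled by its values on projections. -/
theorem predual_norm_le {μ : X} {M : ℝ} (h : ∀ p : ProjAlg A, ‖e p.1 μ‖ ≤ M) :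
    ‖μ‖ ≤ 6 * M := by
  have hM : 0 ≤ M := (norm_nonneg _).trans (h ⊥)
  have hball : ∀ a : A, ‖a‖ ≤ 1 → ‖e a μ‖ ≤ 6 * M := by
    intro a ha
    have h1 := norm_le_of_mem_realUnitBall e h (half_add_star_mem_realUnitBall ha)
    have h2 := norm_le_of_mem_realUnitBall e h (half_sub_star_mem_realUnitBall ha)
    -- Real and imaginary parts each contribute `3 * M`.
    have h3 : a = (1 / 2 : ℂ) • (a + star a) +
        Complex.I • ((-Complex.I / 2) • (a - star a)) := by
      rw [smul_smul, show Complex.I * (-Complex.I / 2) = 1 / 2 by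
        linear_combination (-1 / 2 : ℂ) * Complex.I_mul_I, ← smul_add]
      rw [show a + star a + (a - star a) = (2 : ℂ) • a by rw [two_smul]; abel, smul_smul]
      norm_num
    have h4 : e a μ = e ((1 / 2 : ℂ) • (a + star a)) μ +
        Complex.I * e ((-Complex.I / 2) • (a - star a)) μ := by
      conv_lhs => rw [h3]
      rw [map_add, map_smul (c := Complex.I)]
      rfl
    rw [h4]
    refine (norm_add_le _ _).trans ?_
    rw [norm_mul, Complex.norm_I, one_mul]
    linarith
  refine NormedSpace.norm_le_dual_bound ℂ μ (by positivity) fun f => ?_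
  rcases eq_or_ne f 0 with rfl | hf
  · simp
  have hf0 : 0 < ‖f‖ := norm_pos_iff.2 hf
  have h5 := hball (((‖f‖ : ℂ)⁻¹) • e.symm f) (by
    rw [norm_smul, e.symm.norm_map]; simp [hf0.ne'])
  rw [map_smul, e.apply_symm_apply] at h5
  change ‖(‖f‖ : ℂ)⁻¹ • f μ‖ ≤ _ at h5
  rw [norm_smul, norm_inv, Complex.norm_real, norm_norm, inv_mul_le_iff₀ hf0] at h5
  linarith

/-! ### Weak-* continuity of cut-offs and of the involution -/

/-- A map of the unit ball with weak-* closed graph is weak-* continuous. -/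
theorem continuousOn_of_isClosed_graph {T : A → A} (hT : ∀ a, ‖a‖ ≤ 1 → ‖T a‖ ≤ 1)
    {G : Set (WeakDual ℂ X × WeakDual ℂ X)} (hG : IsClosed G)
    (hTG : ∀ a, ‖a‖ ≤ 1 → ((ofWeakDual e).symm a, (ofWeakDual e).symm (T a)) ∈ G)
    (hGT : ∀ a b, ((ofWeakDual e).symm a, (ofWeakDual e).symm b) ∈ G → b = T a) (μ : X) :
    ContinuousOn (fun x : WeakDual ℂ X => e (T (ofWeakDual e x)) μ)
      (WeakDual.toStrongDual ⁻¹' Metric.closedBall 0 1) := by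
  rw [← preimage_ofWeakDual_closedBall e]
  refine (WeakDual.eval_continuous μ).comp_continuousOn
    (f := fun x : WeakDual ℂ X => (ofWeakDual e).symm (T (ofWeakDual e x)))
    ((isCompact_preimage_closedBall e).continuousOn_of_isClosed_graph
      (fun x hx => ?_) hG (fun x hx => ?_) fun x hx y hy hxy => ?_)
  · rw [Set.mem_preimage, mem_closedBall_zero_iff] at hx ⊢
    rw [LinearEquiv.apply_symm_apply]
    exact hT _ hx
  · rw [Set.mem_preimage, mem_closedBall_zero_iff] at hx
    simpa using hTG _ hx
  · have := hGT (ofWeakDual e x) (ofWeakDual e y) (by simpa using hxy)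
    rw [← this, LinearEquiv.symm_apply_apply]

theorem isClosed_forall_norm_add_smul_le (p : A) :
    IsClosed {x : WeakDual ℂ X | ∀ z : ℂ, ‖z‖ ≤ 1 → ‖ofWeakDual e x + z • p‖ ≤ 1} := by
  simp only [Set.ofPred_forall]
  exact isClosed_iInter fun z => isClosed_iInter fun _ => isClosed_norm_ofWeakDual_add_le e _ _

variable [CompleteSpace X]

/-- The predual is closed under multiplication by projections. -/
theorem exists_predual_mul {p : A} (hp : IsStarProjection p) (μ : X) :
    ∃ μ' : X, ∀ a : A, e a μ' = e (p * a) μ := by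
  have hnorm : ∀ {q : A}, IsStarProjection q → ∀ a, ‖a‖ ≤ 1 → ‖(1 - q) * a‖ ≤ 1 := by
    intro q hq a ha
    simpa using norm_add_smul_le_one hq ha (z := 0) (by simp)
  -- The graph relation says that `1 - p` kills `y` and `p` kills `x - y`, which means `y = p * x`;
  -- both conditions are stated by norm inequalities so as to be weak-* closed.
  have hcont := continuousOn_of_isClosed_graph e (T := fun a => p * a)
    (G := {xy | xy.2 ∈ {x | ∀ z : ℂ, ‖z‖ ≤ 1 → ‖ofWeakDual e x + z • (1 - p)‖ ≤ 1} ∧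
      xy.1 - xy.2 ∈ {x | ∀ z : ℂ, ‖z‖ ≤ 1 → ‖ofWeakDual e x + z • p‖ ≤ 1}})
    (fun a ha => by simpa using hnorm hp.one_sub a ha)
    (((isClosed_forall_norm_add_smul_le e _).preimage continuous_snd).inter
      ((isClosed_forall_norm_add_smul_le e _).preimage (continuous_fst.sub continuous_snd)))
    (fun a ha => by
      refine ⟨fun z hz => ?_, fun z hz => ?_⟩
      · simpa using norm_add_smul_le_one hp.one_sub ha hz
      · have := norm_add_smul_le_one hp ha hz
        rw [sub_mul, one_mul] at this
        simpa using this)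
    (fun a b hab => by
      have h1 := mul_eq_zero_of_forall_norm_le (a := b) hp.one_sub (by simpa using hab.1)
      have h2 := mul_eq_zero_of_forall_norm_le (a := a - b) hp (by simpa using hab.2)
      linear_combination h1 - h2) μ
  obtain ⟨μ', hμ'⟩ := WeakDual.exists_eq_eval_of_continuousOn_closedBall
    { toFun := fun x => e (p * e.symm x) μ
      map_add' := fun x y => by rw [map_add, mul_add, map_add]; rfl
      map_smul' := fun c x => by rw [map_smul, mul_smul_comm, map_smul]; rfl } hcont
  refine ⟨μ', fun a => ?_⟩
  have h := hμ' (e a)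
  change e (p * e.symm (e a)) μ = e a μ' at h
  rw [← h, e.symm_apply_apply]

/-- The predual is closed under the involution. -/
theorem exists_predual_star (μ : X) : ∃ μ' : X, ∀ a : A, e a μ' = star (e (star a) μ) := by
  -- `y = star x` holds as soon as `(x + y) / 2` and `(x - y) / 2i` are self-adjoint, and weak-*
  -- closedness of `realUnitBall` makes this a closed relation.
  have hcont := continuousOn_of_isClosed_graph e (T := fun a => star a)
    (G := {xy | (1 / 2 : ℂ) • (xy.1 + xy.2) ∈ ofWeakDual e ⁻¹' realUnitBall A ∧
      (-Complex.I / 2) • (xy.1 - xy.2) ∈ ofWeakDual e ⁻¹' realUnitBall A})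
    (fun a ha => by rwa [norm_star])
    (((isClosed_preimage_realUnitBall e).preimage (by fun_prop)).inter
      ((isClosed_preimage_realUnitBall e).preimage (by fun_prop)))
    (fun a ha => by
      refine ⟨?_, ?_⟩
      · simpa using half_add_star_mem_realUnitBall ha
      · simpa using half_sub_star_mem_realUnitBall ha)
    (fun a b hab => by
      refine ext_character fun χ => ?_
      have h1 := (hab.1 χ).1
      have h2 := (hab.2 χ).1
      simp only [map_smul, map_add, map_sub, LinearEquiv.apply_symm_apply, smul_eq_mul] at h1 h2
      rw [character_star]
      simp at h1 h2
      refine Complex.ext ?_ ?_ <;> simp <;> linarith) μ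
  obtain ⟨μ', hμ'⟩ := WeakDual.exists_eq_eval_of_continuousOn_closedBall
    { toFun := fun x => star (e (star (e.symm x)) μ)
      map_add' := fun x y => by rw [map_add, star_add, map_add, ← star_add]; rfl
      map_smul' := fun c x => by
        rw [map_smul, star_smul, map_smul]
        change star (star c * _) = c * _
        rw [star_mul', star_star]
        rfl } hcont.star
  refine ⟨μ', fun a => ?_⟩
  have h := hμ' (e a)
  change star (e (star (e.symm (e a))) μ) = e a μ' at h
  rw [← h, e.symm_apply_apply]

end CommCStarAlgebra

/-! ### Suprema of projections and continuity of predual elements -/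

theorem IsContinuousComplexValuation.re {L : Type*} [DistribLattice L] [OrderBot L] {ν : L → ℂ}
    (hν : IsContinuousComplexValuation ν) : IsContinuousRealValuation (fun x => (ν x).re) where
  map_bot := by rw [hν.map_bot, Complex.zero_re]
  map_add_map x y := by rw [← Complex.add_re, hν.map_add_map, Complex.add_re]
  tendsto_of_isLUB I s hne hd hs :=
    (Complex.continuous_re.tendsto _).comp (hν.tendsto_of_isLUB I s hne hd hs)

theorem IsContinuousComplexValuation.im {L : Type*} [DistribLattice L] [OrderBot L] {ν : L → ℂ}
    (hν : IsContinuousComplexValuation ν) : IsContinuousRealValuation (fun x => (ν x).im) where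
  map_bot := by rw [hν.map_bot, Complex.zero_im]
  map_add_map x y := by rw [← Complex.add_im, hν.map_add_map, Complex.add_im]
  tendsto_of_isLUB I s hne hd hs :=
    (Complex.continuous_im.tendsto _).comp (hν.tendsto_of_isLUB I s hne hd hs)

namespace CommCStarAlgebra

open WeakDual

variable {A X : Type*} [CommCStarAlgebra A] [NormedAddCommGroup X] [NormedSpace ℂ X]
  (e : A ≃ₗᵢ[ℂ] StrongDual ℂ X)

theorem proj_mem_effects (p : ProjAlg A) : p.1 ∈ effects A := by
  intro χ
  rcases character_proj p.2 χ with h | h <;> simp [h]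

/-- A character sending `p` to `1` also sends `c` to `1`, so squaring `c` preserves the bound. This
is used to show that the limit of a directed family of projections is idempotent. -/
theorem mul_self_sub_mem_effects {c p : A} (hc : c ∈ effects A) (hp : IsStarProjection p)
    (h : c - p ∈ effects A) : c * c - p ∈ effects A := by
  refine mem_effects_of_character_eq (fun χ => (χ c).re ^ 2 - (χ p).re) fun χ => ?_
  obtain ⟨-, h0, h1⟩ := hc χ
  have h2 := (h χ).2.1
  rw [map_sub, Complex.sub_re] at h2
  refine ⟨?_, ?_⟩
  · rw [map_sub, map_mul, character_eq_re hc, character_eq_re (proj_mem_effects ⟨p, hp⟩)]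
    simp only [Complex.ofReal_re]
    push_cast
    ring
  · rcases character_proj hp χ with h3 | h3 <;> rw [h3] at h2 ⊢ <;>
      simp only [Complex.zero_re, Complex.one_re, sub_zero] at h2 ⊢ <;> constructor <;> nlinarith

theorem mul_self_eq_of_mul_self_sub_mem_effects {c : A} (hc : c ∈ effects A)
    (h : c * c - c ∈ effects A) : c * c = c := by
  refine ext_character fun χ => ?_
  obtain ⟨-, h0, h1⟩ := hc χ
  have h2 := (h χ).2.1
  rw [map_sub, map_mul, character_eq_re hc, ← Complex.ofReal_mul, ← Complex.ofReal_sub,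
    Complex.ofReal_re] at h2
  rw [map_mul, character_eq_re hc, ← Complex.ofReal_mul]
  congr 1
  nlinarith

theorem isClosed_sub_mem_effects (b : A) :
    IsClosed {x : WeakDual ℂ X | ofWeakDual e x - b ∈ effects A} := by
  have : {x : WeakDual ℂ X | ofWeakDual e x - b ∈ effects A} =
      (fun x => x - (ofWeakDual e).symm b) ⁻¹' (ofWeakDual e ⁻¹' effects A) := by
    ext x
    simp
  rw [this]
  exact (isCompact_preimage_effects e).isClosed.preimage (by fun_prop)

theorem isClosed_sub_mem_effects' (b : A) :
    IsClosed {x : WeakDual ℂ X | b - ofWeakDual e x ∈ effects A} := by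
  have : {x : WeakDual ℂ X | b - ofWeakDual e x ∈ effects A} =
      (fun x => (ofWeakDual e).symm b - x) ⁻¹' (ofWeakDual e ⁻¹' effects A) := by
    ext x
    simp
  rw [this]
  exact (isCompact_preimage_effects e).isClosed.preimage (by fun_prop)

/-- By compactness the ultrafilter has a weak-* limit `c`, and closedness of the order relations
makes `c` the least upper bound among effects. -/
theorem exists_isLUB_tendsto_ultrafilter {I : Set (ProjAlg A)} (U : Ultrafilter I)
    (hU : (U : Filter I) ≤ atTop) :
    ∃ s : ProjAlg A, IsLUB I s ∧
      ∀ μ : X, Tendsto (fun x : I => e x.1.1 μ) U (𝓝 (e s.1 μ)) := by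
  let F : I → WeakDual ℂ X := fun x => (ofWeakDual e).symm x.1.1
  obtain ⟨x₀, hx₀, hlim⟩ := (isCompact_preimage_effects e).ultrafilter_le_nhds (U.map F)
    (le_principal_iff.2 (mem_map.2 (Eventually.of_forall fun x => by
      simpa [F] using proj_mem_effects x.1)))
  have hlim : Tendsto F U (𝓝 x₀) := hlim
  set c := ofWeakDual e x₀ with hc
  have hcp : ∀ p ∈ I, c - p.1 ∈ effects A := by
    intro p hp
    refine (isClosed_sub_mem_effects e p.1).mem_of_tendsto hlim ?_
    filter_upwards [hU (eventually_ge_atTop (⟨p, hp⟩ : I))] with y hy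
    simpa [F] using (sub_mem_effects_iff p.2 y.1.2).2 hy
  have hcb : ∀ b : A, (∀ p ∈ I, b - p.1 ∈ effects A) → b - c ∈ effects A := by
    intro b hb
    refine (isClosed_sub_mem_effects' e b).mem_of_tendsto hlim (Eventually.of_forall fun y => ?_)
    simpa [F] using hb y y.2
  -- `c²` is also an upper bound of `I`, so `c ≤ c²`; the reverse inequality holds for every effect.
  have hproj : IsStarProjection c := isStarProjection_of_mem_effects hx₀
    (mul_self_eq_of_mul_self_sub_mem_effects hx₀
      (hcb _ fun p hp => mul_self_sub_mem_effects hx₀ p.2 (hcp p hp)))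
  refine ⟨⟨c, hproj⟩, ⟨fun p hp => (sub_mem_effects_iff p.2 hproj).1 (hcp p hp), fun b hb => ?_⟩,
    fun μ => ?_⟩
  · exact (sub_mem_effects_iff hproj b.2).1
      (hcb _ fun p hp => (sub_mem_effects_iff p.2 b.2).2 (hb hp))
  · change Tendsto _ _ (𝓝 (e (ofWeakDual e x₀) μ))
    rw [apply_ofWeakDual]
    exact ((WeakDual.eval_continuous μ).tendsto x₀).comp hlim

theorem exists_isLUB_projAlg (e : A ≃ₗᵢ[ℂ] StrongDual ℂ X) (I : Set (ProjAlg A)) (hne : I.Nonempty)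
    (hd : DirectedOn (· ≤ ·) I) : ∃ s, IsLUB I s := by
  have := hd.atTop_neBot hne
  obtain ⟨s, hs, -⟩ := exists_isLUB_tendsto_ultrafilter e _
    (Ultrafilter.of_le (atTop : Filter I))
  exact ⟨s, hs⟩

/-- Elements of the predual restrict to continuous valuations. -/
theorem isContinuousComplexValuation_predualRestrict (μ : X) :
    IsContinuousComplexValuation (predualRestrict e μ) where
  map_bot := by
    change e 0 μ = 0
    simp
  map_add_map x y := by
    change e x.1 μ + e y.1 μ = e (x.1 + y.1 - x.1 * y.1) μ + e (x.1 * y.1) μ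
    simp
  tendsto_of_isLUB I s hne hd hs := by
    rw [tendsto_iff_ultrafilter]
    intro U hU
    obtain ⟨t, ht, hlim⟩ := exists_isLUB_tendsto_ultrafilter e U hU
    rw [hs.unique ht]
    exact hlim μ

/-! ### Radon–Nikodym: representing valuations by the predual -/

/-- The real functions on projections that come from the predual. -/
def IsRepresentable (f : ProjAlg A → ℝ) : Prop :=
  ∃ μ : X, ∀ r : ProjAlg A, e r.1 μ = (f r : ℂ)

namespace IsRepresentable

variable {e} {f g : ProjAlg A → ℝ}

theorem add (hf : IsRepresentable e f) (hg : IsRepresentable e g) :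
    IsRepresentable e (fun r => f r + g r) := by
  obtain ⟨μ, hμ⟩ := hf
  obtain ⟨ν, hν⟩ := hg
  exact ⟨μ + ν, fun r => by rw [map_add, hμ, hν, Complex.ofReal_add]⟩

theorem const_mul (hf : IsRepresentable e f) (c : ℝ) :
    IsRepresentable e (fun r => c * f r) := by
  obtain ⟨μ, hμ⟩ := hf
  exact ⟨(c : ℂ) • μ, fun r => by rw [map_smul, hμ, smul_eq_mul, Complex.ofReal_mul]⟩

variable [CompleteSpace X]

theorem inf_left (hf : IsRepresentable e f) (p : ProjAlg A) :
    IsRepresentable e (fun r => f (p ⊓ r)) := by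
  obtain ⟨μ, hμ⟩ := hf
  obtain ⟨μ', hμ'⟩ := exists_predual_mul e p.2 μ
  exact ⟨μ', fun r => by rw [hμ', ← hμ]; rfl⟩

theorem re_predual (μ : X) : IsRepresentable e (fun r => (e r.1 μ).re) := by
  obtain ⟨μ', hμ'⟩ := exists_predual_star e μ
  refine ⟨(1 / 2 : ℂ) • (μ + μ'), fun r => ?_⟩
  rw [map_smul, map_add, hμ', r.2.isSelfAdjoint.star_eq, Complex.star_def, Complex.add_conj,
    smul_eq_mul]
  push_cast
  ring

/-- By `predual_norm_le`, representatives of a uniformly Cauchy sequence are Cauchy in norm, and `X`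
is complete. -/
theorem of_forall_exists_abs_sub_le
    (h : ∀ ε > 0, ∃ g, IsRepresentable e g ∧ ∀ r, |f r - g r| ≤ ε) : IsRepresentable e f := by
  choose g hg hfg using fun n : ℕ => h (1 / ((n : ℝ) + 1)) (by positivity)
  choose μ hμ using hg
  have hgg : ∀ m n r, |g m r - g n r| ≤ 1 / ((m : ℝ) + 1) + 1 / ((n : ℝ) + 1) := by
    intro m n r
    rw [show g m r - g n r = (f r - g n r) - (f r - g m r) by ring]
    linarith [abs_sub (f r - g n r) (f r - g m r), hfg m r, hfg n r]
  have hμμ : ∀ m n, ‖μ m - μ n‖ ≤ 6 * (1 / ((m : ℝ) + 1) + 1 / ((n : ℝ) + 1)) := by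
    refine fun m n => predual_norm_le e fun p => ?_
    rw [map_sub, hμ, hμ, ← Complex.ofReal_sub, Complex.norm_real]
    exact hgg m n p
  have hcauchy : CauchySeq μ := by
    rw [Metric.cauchySeq_iff']
    intro ε hε
    obtain ⟨N, hN⟩ := exists_nat_one_div_lt (show (0 : ℝ) < ε / 12 by positivity)
    refine ⟨N, fun n hn => ?_⟩
    rw [dist_eq_norm]
    have h1 : 1 / ((n : ℝ) + 1) ≤ 1 / ((N : ℝ) + 1) := Nat.one_div_le_one_div hn
    linarith [hμμ n N]
  obtain ⟨ν, hν⟩ := cauchySeq_tendsto_of_complete hcauchy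
  refine ⟨ν, fun r => tendsto_nhds_unique (((e r.1).continuous.tendsto ν).comp hν) ?_⟩
  have hlim : Tendsto (fun n => g n r) atTop (𝓝 (f r)) := by
    rw [tendsto_iff_norm_sub_tendsto_zero]
    refine squeeze_zero (fun _ => norm_nonneg _) (fun n => ?_)
      (tendsto_one_div_add_atTop_nhds_zero_nat (𝕜 := ℝ))
    rw [norm_sub_rev]
    exact hfg n r
  refine ((Complex.continuous_ofReal.tendsto _).comp hlim).congr fun n => ?_
  exact (hμ n r).symm

end IsRepresentable

variable [CompleteSpace X]

/-- Some predual element is nonzero at `p`; the positive Hahn part of its real part, after a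
rotation, is still positive at `p`. -/
theorem exists_isRepresentable_pos {p : ProjAlg A} (hp : p ≠ ⊥) :
    ∃ f : ProjAlg A → ℝ, IsRepresentable e f ∧ IsContinuousRealValuation f ∧
      (∀ r, 0 ≤ f r) ∧ 0 < f p := by
  have hp0 : p.1 ≠ 0 := fun h => hp (Subtype.ext h)
  obtain ⟨μ, hμ⟩ : ∃ μ, e p.1 μ ≠ 0 := by
    by_contra! h
    exact hp0 (e.map_eq_zero_iff.1 (ContinuousLinearMap.ext h))
  -- This scalar makes the value at `p` equal to `|e p μ|²`, so that its real part is positive.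
  set ν := star (e p.1 μ) • μ with hν
  have hval := (isContinuousComplexValuation_predualRestrict e ν).re
  have hpos : 0 < (e p.1 ν).re := by
    rw [hν, map_smul, smul_eq_mul, Complex.star_def, ← Complex.normSq_eq_conj_mul_self,
      Complex.ofReal_re]
    exact Complex.normSq_pos.2 hμ
  obtain ⟨P, hP, hP'⟩ := hval.exists_hahn (exists_isLUB_projAlg e)
  refine ⟨_, (IsRepresentable.re_predual ν).inf_left P, hval.inf_left P,
    fun r => hP _ inf_le_left, ?_⟩
  have h1 := hval.map_inf_add_map_sdiff p P
  have h2 := hP' (p \ P) disjoint_sdiff_self_left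
  rw [inf_comm] at h1
  change (predualRestrict e ν (P ⊓ p)).re + _ = (e p.1 ν).re at h1
  change 0 < (predualRestrict e ν (P ⊓ p)).re
  linarith

/-- A positive valuation dominated by a representable one is representable. -/
theorem isRepresentable_of_le {ν f : ProjAlg A → ℝ} (hν : IsContinuousRealValuation ν)
    (hf : IsContinuousRealValuation f) (hfe : IsRepresentable e f) (h0 : ∀ r, 0 ≤ ν r)
    (hle : ∀ r, ν r ≤ f r) : IsRepresentable e ν := by
  have hf0 : ∀ r, 0 ≤ f r := fun r => (h0 r).trans (hle r)
  -- Binary expansion of the density of `ν` with respect to `f`: the next digit is `1` exactly on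
  -- the Hahn set `P` where the remainder exceeds `c * f`. The remainder there lies between `c * f`
  -- and `2 * c * f`, and elsewhere between `0` and `c * f`.
  have step : ∀ n : ℕ, ∃ g, IsRepresentable e g ∧ IsContinuousRealValuation g ∧
      ∀ r, 0 ≤ ν r - g r ∧ ν r - g r ≤ (1 / 2) ^ n * f r := by
    intro n
    induction n with
    | zero =>
      refine ⟨fun r => 0 * f r, hfe.const_mul 0, hf.const_mul 0, fun r => ?_⟩
      simpa using ⟨h0 r, hle r⟩
    | succ n ih =>
      obtain ⟨g, hge, hg, hgr⟩ := ih
      set c : ℝ := (1 / 2) ^ (n + 1) with hc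
      have hc2 : ((1 : ℝ) / 2) ^ n = 2 * c := by rw [hc, pow_succ]; ring
      obtain ⟨P, hP, hP'⟩ := ((hν.sub hg).sub (hf.const_mul c)).exists_hahn
        (exists_isLUB_projAlg e)
      have hnew : IsContinuousRealValuation (fun r => g r - (-c) * f (P ⊓ r)) :=
        hg.sub ((hf.inf_left P).const_mul (-c))
      refine ⟨_, ?_, hnew, fun r => ?_⟩
      · have := hge.add ((hfe.inf_left P).const_mul c)
        convert this using 2 with r
        ring
      · have h1 := (hν.sub hg).map_inf_add_map_sdiff r P
        have h2 := hf.map_inf_add_map_sdiff r P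
        have h3 := hP (r ⊓ P) inf_le_right
        have h4 := hP' (r \ P) disjoint_sdiff_self_left
        have h5 := hgr (r ⊓ P)
        have h6 := hgr (r \ P)
        have h7 : c * f r = c * f (r ⊓ P) + c * f (r \ P) := by rw [← mul_add, h2]
        rw [hc2] at h5 h6
        rw [inf_comm P r]
        constructor <;> linarith
  refine IsRepresentable.of_forall_exists_abs_sub_le fun ε hε => ?_
  obtain ⟨n, hn⟩ := exists_pow_lt_of_lt_one (show 0 < ε / (f ⊤ + 1) by
    have := hf0 ⊤; positivity) (show (1 / 2 : ℝ) < 1 by norm_num)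
  obtain ⟨g, hge, -, hgr⟩ := step n
  refine ⟨g, hge, fun r => ?_⟩
  rw [abs_of_nonneg (hgr r).1]
  have htop : f r ≤ f ⊤ := by
    have := hf.map_inf_add_map_sdiff ⊤ r
    rw [top_inf_eq] at this
    linarith [hf0 (⊤ \ r)]
  have hpos : 0 < f ⊤ + 1 := by linarith [hf0 ⊤]
  rw [lt_div_iff₀ hpos] at hn
  have hpow : (0 : ℝ) ≤ (1 / 2) ^ n := by positivity
  nlinarith [(hgr r).2]

theorem isRepresentable_of_nonneg {ν : ProjAlg A → ℝ} (hν : IsContinuousRealValuation ν)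
    (h0 : ∀ r, 0 ≤ ν r) : IsRepresentable e ν := by
  set J : Set (ProjAlg A) := {q | IsRepresentable e (fun r => ν (q ⊓ r))} with hJ
  have hne : J.Nonempty := ⟨⊥, 0, fun r => by simp [hν.map_bot]⟩
  have hd : DirectedOn (· ≤ ·) J := by
    intro q₁ h₁ q₂ h₂
    refine ⟨q₁ ⊔ q₂, ?_, le_sup_left, le_sup_right⟩
    have h := IsRepresentable.add h₁ (IsRepresentable.inf_left h₂ q₁ᶜ)
    have heq : (fun r => ν ((q₁ ⊔ q₂) ⊓ r)) = fun r => ν (q₁ ⊓ r) + ν (q₂ ⊓ (q₁ᶜ ⊓ r)) := by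
      funext r
      rw [← hν.map_inf_add_map_sdiff ((q₁ ⊔ q₂) ⊓ r) q₁]
      congr 2
      · rw [inf_right_comm, inf_eq_right.2 (le_sup_left : q₁ ≤ q₁ ⊔ q₂)]
      · rw [sdiff_eq, inf_right_comm, inf_sup_right, inf_compl_eq_bot, bot_sup_eq, inf_assoc]
    rw [hJ, Set.mem_ofPred_eq, heq]
    exact h
  obtain ⟨s, hs⟩ := exists_isLUB_projAlg e J hne hd
  -- For `q ≤ s` the cut-offs of `ν` to `s` and to `q` differ uniformly by at most `ν (s \ q)`,
  -- which continuity makes small.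
  have hsJ : s ∈ J := by
    refine IsRepresentable.of_forall_exists_abs_sub_le fun ε hε => ?_
    have := hd.atTop_neBot hne
    obtain ⟨q, hq⟩ := ((hν.tendsto_of_isLUB J s hne hd hs).eventually
      (lt_mem_nhds (show ν s - ε < ν s by linarith))).exists
    refine ⟨_, q.2, fun r => ?_⟩
    have hqs : (q : ProjAlg A) ≤ s := hs.1 q.2
    have h1 := hν.map_inf_add_map_sdiff (s ⊓ r) q
    have h2 := hν.map_inf_add_map_sdiff s q
    have h3 := hν.map_inf_add_map_sdiff (s \ q) r
    rw [inf_right_comm, inf_eq_right.2 hqs, ← sdiff_inf_right_comm] at h1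
    rw [inf_eq_right.2 hqs] at h2
    have h4 := h0 (s \ q ⊓ r)
    have h5 := h0 ((s \ q) \ r)
    rw [abs_le]
    constructor <;> linarith
  have htop : s = ⊤ := by
    by_contra hs1
    obtain ⟨f, hfe, hf, hf0, hfp⟩ := exists_isRepresentable_pos e
      (show sᶜ ≠ ⊥ by rwa [Ne, compl_eq_bot])
    -- The scaling makes `c * f` exceed `ν` by exactly `1` at `sᶜ`. The part of `sᶜ` where `c * f`
    -- dominates `ν` belongs to `J`, so it is both below and disjoint from `s` and vanishes; then `c
    -- * f - ν` would be nonpositive at `sᶜ`.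
    set c : ℝ := (ν sᶜ + 1) / f sᶜ with hc
    have hcf : c * f sᶜ = ν sᶜ + 1 := div_mul_cancel₀ _ hfp.ne'
    have hval := (hf.const_mul c).sub hν
    obtain ⟨P, hP, hP'⟩ := hval.exists_hahn (exists_isLUB_projAlg e)
    have hqJ : sᶜ ⊓ P ∈ J := isRepresentable_of_le e (hν.inf_left _)
      ((hf.const_mul c).inf_left (sᶜ ⊓ P)) ((hfe.const_mul c).inf_left _) (fun r => h0 _)
      fun r => sub_nonneg.1 (hP _ (inf_le_left.trans inf_le_right))
    have hq0 : sᶜ ⊓ P = ⊥ := by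
      refine disjoint_self.1 ((disjoint_compl_left (a := s)).mono inf_le_left (hs.1 hqJ))
    have h1 := hval.map_inf_add_map_sdiff sᶜ P
    have h2 := hP' (sᶜ \ P) disjoint_sdiff_self_left
    rw [hq0, hval.map_bot] at h1
    linarith
  rw [hJ, Set.mem_ofPred_eq, htop] at hsJ
  simpa using hsJ

/-- Every real continuous valuation on the projections comes from the predual. -/
theorem isRepresentable_of_isContinuousRealValuation {ν : ProjAlg A → ℝ}
    (hν : IsContinuousRealValuation ν) : IsRepresentable e ν := by
  obtain ⟨P, hP, hP'⟩ := hν.exists_hahn (exists_isLUB_projAlg e)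
  have h1 := isRepresentable_of_nonneg e (hν.inf_left P) fun r => hP _ inf_le_left
  have h2 := isRepresentable_of_nonneg e ((hν.const_mul (-1)).inf_left Pᶜ) fun r => by
    have := hP' (Pᶜ ⊓ r) (disjoint_compl_left.mono_left inf_le_left)
    linarith
  have h3 := h1.add (h2.const_mul (-1))
  convert h3 using 2 with r
  have := hν.map_inf_add_map_sdiff r P
  rw [sdiff_eq, inf_comm r P, inf_comm r Pᶜ] at this
  linarith

end CommCStarAlgebra

theorem mainTheorem7 {A : Type*} [CommCStarAlgebra A]
    {X : Type*} [NormedAddCommGroup X] [NormedSpace ℂ X] [CompleteSpace X]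
    (e : A ≃ₗᵢ[ℂ] StrongDual ℂ X) :
    Set.BijOn (predualRestrict e) Set.univ
      (continuousComplexValuations (ProjAlg A) : Set (ProjAlg A → ℂ)) := by
  refine ⟨fun μ _ => CommCStarAlgebra.isContinuousComplexValuation_predualRestrict e μ,
    fun μ _ ν _ h => ?_, fun ν hν => ?_⟩
  · have hnorm : ‖μ - ν‖ ≤ 6 * 0 := CommCStarAlgebra.predual_norm_le e fun p => by
      have hp : e p.1 μ = e p.1 ν := congrFun h p
      rw [map_sub, hp, sub_self, norm_zero]
    rw [mul_zero] at hnorm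
    exact sub_eq_zero.1 (norm_le_zero_iff.1 hnorm)
  · have hν : IsContinuousComplexValuation ν := hν
    obtain ⟨μ₁, h₁⟩ := CommCStarAlgebra.isRepresentable_of_isContinuousRealValuation e hν.re
    obtain ⟨μ₂, h₂⟩ := CommCStarAlgebra.isRepresentable_of_isContinuousRealValuation e hν.im
    refine ⟨μ₁ + Complex.I • μ₂, trivial, funext fun p => ?_⟩
    change e p.1 (μ₁ + Complex.I • μ₂) = ν p
    rw [map_add, map_smul, h₁, h₂, smul_eq_mul, mul_comm, Complex.re_add_im]
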